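/- Let $p \ge 1$ and let $n_1,\dots,n_p \ge 1$ be integers. Write $\mathcal H_n = \mathbb C^n$ for the complex Hilbert space of dimension $n$, and give $\mathcal H = \mathcal H_{n_1} \otimes \cdots \otimes \mathcal H_{n_p}$ the tensor product inner product. A pure state is a vector of norm $1$; a pure state of $\mathcal H$ is separable if it is of the form $|w_1\rangle \otimes \cdots \otimes |w_p\rangle$ with pure states $|w_i\rangle \in \mathcal H_{n_i}$. For $v \in \mathcal H$ define the geometric measure of entanglement by $$E(v) = 1 - \sup\{ |\langle w | v\rangle|^2 : w \in \mathcal H \text{ a separable pure state} \}.$$ For a permutation $\sigma$ of $\{1,\dots,p\}$ with $n_{\sigma(i)} = n_i$ for all $i$, let $S_\sigma : \mathcal H \to \mathcal H$ be the swap operator, i.e. the linear operator determined by $S_\sigma(|v_1\rangle \otimes \cdots \otimes |v_p\rangle) = |v_{\sigma(1)}\rangle \otimes \cdots \otimes |v_{\sigma(p)}\rangle$. Let $U : \mathcal H \to \mathcal H$ be a linear operator. Then $E(U|v\rangle) = E(|v\rangle)$ for all pure states $|v\rangle \in \mathcal H$ if and only if there exist unitary operators $U_i$ on $\mathcal H_{n_i}$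 ($1 \le i \le p$) and a permutation $\sigma$ of $\{1,\dots,p\}$ with $n_{\sigma(i)} = n_i$ for all $i$ such that $U = S_\sigma(U_1 \otimes \cdots \otimes U_p)$. -/

import Mathlib

open scoped TensorProduct InnerProductSpace

noncomputable section

namespace Multipartite

/-- The complex Hilbert space of dimension `d`. -/
abbrev Hil (d : ℕ) : Type := EuclideanSpace ℂ (Fin d)

/-- The algebraic tensor product of the Hilbert spaces of dimensions `n 0, …, n (p - 1)`.
Mathlib puts the projective tensor norm on this type; that norm is never used here. The Hilbert
space structure is the one given by `braket` below. -/
abbrev Space {p : ℕ} (n : Fin p → ℕ) : Type := ⨂[ℂ] i : Fin p, Hil (n i)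

/-- Coordinates with respect to the product basis `e_{f 0} ⊗ ⋯ ⊗ e_{f (p - 1)}`. -/
def coords {p : ℕ} (n : Fin p → ℕ) :
    Space n ≃ₗ[ℂ] EuclideanSpace ℂ ((i : Fin p) → Fin (n i)) :=
  (Basis.piTensorProduct fun i => (EuclideanSpace.basisFun (Fin (n i)) ℂ).toBasis).equivFun ≪≫ₗ
    (WithLp.linearEquiv 2 ℂ (((i : Fin p) → Fin (n i)) → ℂ)).symm

theorem coords_tprod {p : ℕ} (n : Fin p → ℕ) (v : (i : Fin p) → Hil (n i))
    (f : (i : Fin p) → Fin (n i)) :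
    coords n (PiTensorProduct.tprod ℂ v) f = ∏ i, v i (f i) := by
  simp [coords]

/-- The inner product `⟨x|y⟩` of the tensor product Hilbert space (conjugate linear in `x`): the one
for which the product basis is orthonormal. By `braket_tprod` it is the sesquilinear form with
`⟨v₁ ⊗ ⋯ ⊗ v_p | w₁ ⊗ ⋯ ⊗ w_p⟩ = ∏ i, ⟨v_i|w_i⟩`. -/
def braket {p : ℕ} {n : Fin p → ℕ} (x y : Space n) : ℂ :=
  ⟪coords n x, coords n y⟫_ℂ

theorem braket_tprod {p : ℕ} {n : Fin p → ℕ} (v w : (i : Fin p) → Hil (n i)) :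
    braket (PiTensorProduct.tprod ℂ v) (PiTensorProduct.tprod ℂ w) = ∏ i, ⟪v i, w i⟫_ℂ := by
  simp only [braket, PiLp.inner_apply, coords_tprod]
  rw [Finset.prod_univ_sum, Fintype.piFinset_univ]
  refine Finset.sum_congr rfl fun f _ => ?_
  simp [Finset.prod_mul_distrib]

/-- A pure state is a vector of length one. -/
def IsPureState {p : ℕ} {n : Fin p → ℕ} (v : Space n) : Prop := braket v v = 1

/-- A separable pure state is a tensor product of pure states of the subsystems. -/
def IsSeparable {p : ℕ} {n : Fin p → ℕ} (w : Space n) : Prop :=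
  ∃ a : (i : Fin p) → Hil (n i), (∀ i, ‖a i‖ = 1) ∧ w = PiTensorProduct.tprod ℂ a

theorem IsSeparable.isPureState {p : ℕ} {n : Fin p → ℕ} {w : Space n} (hw : IsSeparable w) :
    IsPureState w := by
  obtain ⟨a, ha, rfl⟩ := hw
  simp [IsPureState, braket_tprod, inner_self_eq_norm_sq_to_K, ha]

/-- The numbers `|⟨w|v⟩|²`, for `w` a separable pure state. -/
def overlaps {p : ℕ} {n : Fin p → ℕ} (v : Space n) : Set ℝ :=
  {r | ∃ w : Space n, IsSeparable w ∧ r = ‖braket w v‖ ^ 2}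

/-- The geometric measure of entanglement `E(v) = 1 - sup_w |⟨w|v⟩|²`, where the supremum is over
the separable pure states `w`. The next two facts show that it is a genuine supremum. -/
def geomEnt {p : ℕ} {n : Fin p → ℕ} (v : Space n) : ℝ := 1 - sSup (overlaps v)

theorem overlaps_nonempty {p : ℕ} {n : Fin p → ℕ} (hn : ∀ i, 0 < n i) (v : Space n) :
    (overlaps v).Nonempty :=
  ⟨_, _, ⟨fun i => EuclideanSpace.single ⟨0, hn i⟩ 1, by simp, rfl⟩, rfl⟩

theorem overlaps_bddAbove {p : ℕ} {n : Fin p → ℕ} (v : Space n) : BddAbove (overlaps v) := by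
  refine ⟨‖coords n v‖ ^ 2, ?_⟩
  rintro r ⟨w, hw, rfl⟩
  have h1 : ‖coords n w‖ = 1 := by
    have h := hw.isPureState
    rw [IsPureState, braket, inner_self_eq_norm_sq_to_K] at h
    have h2 : ‖coords n w‖ ^ 2 = 1 := Complex.ofReal_injective (by simpa using h)
    nlinarith [norm_nonneg (coords n w)]
  have h2 := norm_inner_le_norm (𝕜 := ℂ) (coords n w) (coords n v)
  rw [h1, one_mul] at h2
  exact pow_le_pow_left₀ (norm_nonneg _) h2 2

/-- The identification of two Hilbert spaces of equal dimension along the standard bases. -/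
def hilCongr {d e : ℕ} (h : d = e) : Hil d ≃ₗᵢ[ℂ] Hil e :=
  LinearIsometryEquiv.piLpCongrLeft 2 ℂ ℂ (finCongr h)

theorem hilCongr_apply {d e : ℕ} (h : d = e) (v : Hil d) (k : Fin e) :
    hilCongr h v k = v (Fin.cast h.symm k) := by
  subst h
  simp [hilCongr]

/-- The swap operator `S_σ : v₁ ⊗ ⋯ ⊗ v_p ↦ v_{σ(1)} ⊗ ⋯ ⊗ v_{σ(p)}`. It is an operator on the same
multipartite space exactly when subsystems `i` and `σ i` have the same dimension for all `i`. -/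
def swapOp {p : ℕ} {n : Fin p → ℕ} (σ : Equiv.Perm (Fin p)) (h : ∀ i, n (σ i) = n i) :
    Space n →ₗ[ℂ] Space n :=
  (PiTensorProduct.map fun i => (hilCongr (h i)).toLinearEquiv.toLinearMap) ∘ₗ
    (PiTensorProduct.reindex ℂ (fun i => Hil (n i)) σ.symm).toLinearMap

theorem swapOp_tprod {p : ℕ} {n : Fin p → ℕ} (σ : Equiv.Perm (Fin p)) (h : ∀ i, n (σ i) = n i)
    (v : (i : Fin p) → Hil (n i)) :
    swapOp σ h (PiTensorProduct.tprod ℂ v) =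
      PiTensorProduct.tprod ℂ fun i => hilCongr (h i) (v (σ i)) := by
  simp only [swapOp, LinearMap.comp_apply, LinearEquiv.coe_coe, PiTensorProduct.reindex_tprod]
  exact PiTensorProduct.map_tprod _ _

end Multipartite

end

/-! Write q(v) for the largest squared overlap of v with a separable state. By homogeneity U
preserves q on all vectors, and q vanishes only at 0, so U is invertible.

The adjoint U† respects separable states. If z is separable, then ‖U†z‖⁴ = |⟨z|UU†z⟩|² ≤ q(UU†z) =
q(U†z) ≤ ‖U†z‖², so ‖U†z‖ ≤ 1. If w is separable, then q(Uw) = q(w) = 1 is attained at some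
separable z, so |⟨U†z|w⟩| = 1, and equality in Cauchy–Schwarz gives w = U†z up to a phase
(`exists_dagger_eq`). The same holds for U⁻¹, so T = (U⁻¹)† and T⁻¹ = U† both preserve separability.

Such a T is a swap of local unitaries (`exists_eq_swapLocal`). Two product vectors whose sum is a
product vector agree, up to scalars, in all slots but one (`parallel_of_tprod_add`). Hence T carries
the vectors that vary in one slot of a base point e to vectors that vary in one slot of T e; this
gives a permutation and isometries between slots. The swap of local unitaries built from them agrees
with T when one slot of e varies, and `map_tprod_eq_self_of_fix` extends this to all product
vectors. Finally, T is unitary, so U = T. -/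

noncomputable section

/-! ### Product vectors over a field and operators preserving them -/

namespace ProductVector

open PiTensorProduct (lift)
open PiTensorProduct renaming tprod → pureTensor
open Function

section Field

variable {ι K : Type*} [Field K] {E : ι → Type*}
  [∀ i, AddCommGroup (E i)] [∀ i, Module K (E i)]

theorem exists_dual_ne_zero {V : Type*} [AddCommGroup V] [Module K V] {x : V} (hx : x ≠ 0) :
    ∃ φ : V →ₗ[K] K, φ x ≠ 0 := by
  obtain ⟨φ, hφ, -⟩ := Submodule.exists_le_ker_of_notMem (K := K) (p := ⊥) (v := x) (by simpa)
  exact ⟨φ, hφ⟩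

/-- If `f` detects only `x` and `g` detects only `y`, then `f + g` detects both. -/
theorem exists_dual_ne_zero_and {V : Type*} [AddCommGroup V] [Module K V] {x y : V}
    (hx : x ≠ 0) (hy : y ≠ 0) : ∃ φ : V →ₗ[K] K, φ x ≠ 0 ∧ φ y ≠ 0 := by
  obtain ⟨f, hf⟩ := exists_dual_ne_zero (K := K) hx
  obtain ⟨g, hg⟩ := exists_dual_ne_zero (K := K) hy
  by_cases h1 : f y = 0
  · by_cases h2 : g x = 0
    · exact ⟨f + g, by simpa [h2], by simpa [h1]⟩
    · exact ⟨g, h2, hg⟩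
  · exact ⟨f, hf, h1⟩

/-- A functional killing `x` but not `y`, when `y` is not a multiple of `x`. -/
theorem exists_dual_eq_zero_ne_zero {V : Type*} [AddCommGroup V] [Module K V] {x y : V}
    (h : ∀ c : K, y ≠ c • x) : ∃ φ : V →ₗ[K] K, φ x = 0 ∧ φ y ≠ 0 := by
  obtain ⟨φ, hφ, hle⟩ := Submodule.exists_le_ker_of_notMem (K := K) (p := K ∙ x) (v := y)
    (by rw [Submodule.mem_span_singleton]; rintro ⟨c, rfl⟩; exact h c rfl)
  exact ⟨φ, by simpa using hle (Submodule.mem_span_singleton_self x), hφ⟩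

theorem ne_zero_of_tprod_ne_zero {a : (i : ι) → E i} (h : pureTensor K a ≠ 0) (i : ι) : a i ≠ 0 :=
  fun h0 => h ((pureTensor K).map_coord_zero i h0)

theorem update_ne_zero [DecidableEq ι] {a : (i : ι) → E i} (ha : ∀ i, a i ≠ 0) {i : ι}
    {z : E i} (hz : z ≠ 0) (k : ι) : update a i z k ≠ 0 := by
  obtain rfl | hk := eq_or_ne k i
  · simpa
  · simpa [hk] using ha k

variable [Fintype ι]

/-- The functional on a tensor product which is the product of functionals on the factors. -/
def prodDual (φ : (i : ι) → E i →ₗ[K] K) : (⨂[K] i, E i) →ₗ[K] K :=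
  lift ((MultilinearMap.mkPiAlgebra K ι K).compLinearMap φ)

@[simp]
theorem prodDual_tprod (φ : (i : ι) → E i →ₗ[K] K) (a : (i : ι) → E i) :
    prodDual φ (pureTensor K a) = ∏ i, φ i (a i) := by
  simp [prodDual]

theorem tprod_ne_zero {a : (i : ι) → E i} (ha : ∀ i, a i ≠ 0) : pureTensor K a ≠ 0 := by
  choose φ hφ using fun i => exists_dual_ne_zero (K := K) (ha i)
  intro h
  have := prodDual_tprod φ a
  rw [h, map_zero] at this
  exact Finset.prod_ne_zero_iff.mpr (fun i _ => hφ i) this.symm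

variable [DecidableEq ι]

/-- The factors of a nonzero product vector are unique up to scalars. -/
theorem exists_smul_of_tprod_eq {a b : (i : ι) → E i} (h : pureTensor K a = pureTensor K b)
    (hb : pureTensor K b ≠ 0) (i : ι) : ∃ c : K, b i = c • a i := by
  by_contra! hc
  obtain ⟨f, hf0, hf1⟩ := exists_dual_eq_zero_ne_zero hc
  choose φ hφ using fun k => exists_dual_ne_zero (K := K) (ne_zero_of_tprod_ne_zero hb k)
  -- The product functional kills `a` through slot `i` but is nonzero on `b` in every slot.
  have h1 := congrArg (prodDual (update φ i f)) h
  rw [prodDual_tprod, prodDual_tprod, Finset.prod_eq_zero (Finset.mem_univ i) (by simpa)] at h1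
  refine Finset.prod_ne_zero_iff.mpr (fun k _ => ?_) h1.symm
  obtain rfl | hk := eq_or_ne k i
  · simpa
  · simpa [hk] using hφ k

theorem prod_update_update (φ : ι → K) {i j : ι} (hij : i ≠ j) (f g : K) :
    ∏ k, update (update φ i f) j g k = f * g * ∏ k ∈ (Finset.univ.erase i).erase j, φ k := by
  rw [← Finset.mul_prod_erase _ _ (Finset.mem_univ i), ← Finset.mul_prod_erase _ _
    (Finset.mem_erase.mpr ⟨hij.symm, Finset.mem_univ j⟩)]
  rw [update_of_ne hij, update_self, update_self, mul_assoc]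
  congr 2
  refine Finset.prod_congr rfl fun k hk => ?_
  simp only [Finset.mem_erase, Finset.mem_univ, and_true] at hk
  rw [update_of_ne hk.1, update_of_ne hk.2]

/-- If the sum of two product vectors is a product vector, then among any two slots there is one
in which they are parallel. -/
theorem parallel_of_tprod_add {a b c : (i : ι) → E i}
    (h : pureTensor K a + pureTensor K b = pureTensor K c)
    (ha : ∀ i, a i ≠ 0) (hb : ∀ i, b i ≠ 0) {i j : ι} (hij : i ≠ j)
    (hi : ∀ r : K, b i ≠ r • a i) : ∃ r : K, b j = r • a j := by
  by_contra! hj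
  have symm' : ∀ k, (∀ r : K, b k ≠ r • a k) → ∀ r : K, a k ≠ r • b k := by
    intro k hk r hr
    have hr0 : r ≠ 0 := by
      rintro rfl
      exact ha k (by simpa using hr)
    exact hk r⁻¹ (by rw [hr, smul_smul, inv_mul_cancel₀ hr0, one_smul])
  obtain ⟨f, hf0, hf1⟩ := exists_dual_eq_zero_ne_zero hi
  obtain ⟨f', hf0', hf1'⟩ := exists_dual_eq_zero_ne_zero (symm' i hi)
  obtain ⟨g, hg0, hg1⟩ := exists_dual_eq_zero_ne_zero hj
  obtain ⟨g', hg0', hg1'⟩ := exists_dual_eq_zero_ne_zero (symm' j hj)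
  choose φ hφa hφb using fun k => exists_dual_ne_zero_and (K := K) (ha k) (hb k)
  have key : ∀ (s : E i →ₗ[K] K) (t : E j →ₗ[K] K) (x : (k : ι) → E k),
      prodDual (update (update φ i s) j t) (pureTensor K x) =
        s (x i) * t (x j) * ∏ k ∈ (Finset.univ.erase i).erase j, φ k (x k) := by
    intro s t x
    rw [prodDual_tprod, ← prod_update_update (fun k => φ k (x k)) hij]
    refine Finset.prod_congr rfl fun k _ => ?_
    obtain rfl | hkj := eq_or_ne k j
    · simp
    · obtain rfl | hki := eq_or_ne k i <;> simp [*]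
  have hP : ∏ k ∈ (Finset.univ.erase i).erase j, φ k (a k) ≠ 0 :=
    Finset.prod_ne_zero_iff.mpr fun k _ => hφa k
  have hQ : ∏ k ∈ (Finset.univ.erase i).erase j, φ k (b k) ≠ 0 :=
    Finset.prod_ne_zero_iff.mpr fun k _ => hφb k
  -- The pair `f, g` sees only `b`, and `f', g'` only `a`, so these functionals are nonzero on `c`.
  -- The mixed pair `f, g'` kills both summands, yet all its factors at `c` are already known to be
  -- nonzero.
  have e1 := congrArg (prodDual (update (update φ i f) j g)) h
  have e2 := congrArg (prodDual (update (update φ i f') j g')) h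
  have e3 := congrArg (prodDual (update (update φ i f) j g')) h
  simp only [map_add, key, hf0, hg0, hf0', hg0', zero_mul, mul_zero, zero_add, add_zero]
    at e1 e2 e3
  have n1 := e1 ▸ mul_ne_zero (mul_ne_zero hf1 hg1) hQ
  have n2 := e2 ▸ mul_ne_zero (mul_ne_zero hf1' hg1') hP
  simp only [ne_eq, mul_eq_zero, not_or] at n1 n2
  exact mul_ne_zero (mul_ne_zero n1.1.1 n2.1.2) n1.2 e3.symm

/-- Multilinearity collects the scalars of all other slots in slot `j`. -/
theorem tprod_eq_tprod_update {a b : (i : ι) → E i} (j : ι)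
    (h : ∀ k, k ≠ j → ∃ r : K, b k = r • a k) :
    ∃ z, pureTensor K b = pureTensor K (update a j z) := by
  have h' : ∀ k, ∃ r : K, k ≠ j → b k = r • a k := fun k =>
    (em (k = j)).elim (fun hk => ⟨0, fun h => absurd hk h⟩)
      fun hk => (h k hk).imp fun r hr _ => hr
  choose r hr using h'
  have hb : b = fun k => (update r j 1 : ι → K) k • update a j (b j) k := by
    funext k
    obtain rfl | hk := eq_or_ne k j
    · simp
    · simp [hk, hr k hk]
  refine ⟨(∏ k, (update r j 1 : ι → K) k) • b j, ?_⟩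
  rw [MultilinearMap.map_update_smul, ← MultilinearMap.map_smul_univ, ← hb]

/-- If the sum of two product vectors is a product vector, then they agree in all slots but one. -/
theorem eq_tprod_update_of_add [Nonempty ι] {a b c : (i : ι) → E i}
    (h : pureTensor K a + pureTensor K b = pureTensor K c) (ha : ∀ i, a i ≠ 0) :
    ∃ j z, pureTensor K b = pureTensor K (update a j z) := by
  by_cases hb : ∀ i, b i ≠ 0
  · by_cases hex : ∃ i, ∀ r : K, b i ≠ r • a i
    · obtain ⟨i, hi⟩ := hex
      exact ⟨i, tprod_eq_tprod_update i fun k hk => parallel_of_tprod_add h ha hb hk.symm hi⟩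
    · push Not at hex
      exact ⟨Classical.arbitrary ι, tprod_eq_tprod_update _ fun k _ => hex k⟩
  · push Not at hb
    obtain ⟨i, hi⟩ := hb
    refine ⟨i, 0, ?_⟩
    rw [(pureTensor K).map_coord_zero i hi, (pureTensor K).map_coord_zero i (by simp)]

/-! ### Operators fixing the product vectors near a base point -/

/-- A linear operator that maps product vectors to product vectors, and fixes the ones obtained
from `x` by resetting one of two slots to values `e i`, `e j` not parallel to the present ones,
maps `x` to a multiple of itself. -/
theorem exists_map_tprod_eq_smul {R : (⨂[K] i, E i) →ₗ[K] (⨂[K] i, E i)}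
    (hinj : Function.Injective R) (hR : ∀ a, ∃ b, R (pureTensor K a) = pureTensor K b)
    {a e : (i : ι) → E i} (ha : ∀ i, a i ≠ 0) (he : ∀ i, e i ≠ 0) {i j : ι} (hij : i ≠ j)
    (hi : ∀ c : K, a i ≠ c • e i) (hj : ∀ c : K, a j ≠ c • e j)
    (hfi : R (pureTensor K (update a i (e i))) = pureTensor K (update a i (e i)))
    (hfj : R (pureTensor K (update a j (e j))) = pureTensor K (update a j (e j)))
    (hfij : R (pureTensor K (update (update a i (e i)) j (e j))) =
      pureTensor K (update (update a i (e i)) j (e j))) :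
    ∃ c : K, R (pureTensor K a) = c • pureTensor K a := by
  have : Nonempty ι := ⟨i⟩
  obtain ⟨x, hx⟩ := hR a
  have hx0 : pureTensor K x ≠ 0 := by
    rw [← hx]
    exact (map_ne_zero_iff R hinj).mpr (tprod_ne_zero ha)
  -- Adding `e k` to slot `k` exhibits the image of `a` plus a fixed product vector as a product
  -- vector, so the two agree outside one slot.
  have main : ∀ k, R (pureTensor K (update a k (e k))) = pureTensor K (update a k (e k)) →
      ∃ l z, pureTensor K x = pureTensor K (update (update a k (e k)) l z) := by
    intro k hk
    obtain ⟨y, hy⟩ := hR (update a k (e k + a k))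
    rw [MultilinearMap.map_update_add, map_add, hk, update_eq_self, hx] at hy
    exact eq_tprod_update_of_add hy (update_ne_zero ha (he k))
  obtain ⟨l, z, h1⟩ := main i hfi
  obtain ⟨l', z', h2⟩ := main j hfj
  have h12 := h2.symm.trans h1
  have h10 : pureTensor K (update (update a i (e i)) l z) ≠ 0 := h1 ▸ hx0
  have h20 : pureTensor K (update (update a j (e j)) l' z') ≠ 0 := h2 ▸ hx0
  have p1 := exists_smul_of_tprod_eq h12 h10
  have p2 := exists_smul_of_tprod_eq h12.symm h20
  by_cases hl : l = i
  · subst hl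
    have hl' : l' = j := by
      by_contra hne
      obtain ⟨c, hc⟩ := p1 j
      rw [update_of_ne hij.symm, update_of_ne hij.symm, update_of_ne (Ne.symm hne),
        update_self] at hc
      exact hj c hc
    subst hl'
    obtain ⟨c, hc⟩ := p1 l
    rw [update_self, update_of_ne hij, update_of_ne hij] at hc
    refine ⟨c, ?_⟩
    rw [hx, h1, hc, MultilinearMap.map_update_smul, update_idem, update_eq_self]
  · exfalso
    have hl' : l' = i := by
      by_contra hne
      obtain ⟨c, hc⟩ := p2 i
      rw [update_of_ne (Ne.symm hl), update_self, update_of_ne (Ne.symm hne),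
        update_of_ne hij] at hc
      exact hi c hc
    subst hl'
    have hlj : l = j := by
      by_contra hne
      obtain ⟨c, hc⟩ := p1 j
      rw [update_of_ne (Ne.symm hne), update_of_ne hij.symm, update_of_ne hij.symm,
        update_self] at hc
      exact hj c hc
    subst hlj
    obtain ⟨c, hc⟩ := p1 l
    rw [update_self, update_of_ne hij.symm, update_self] at hc
    -- Here the image of `a` is a multiple of `a` with both slots reset. That vector is fixed, so
    -- injectivity makes `a` parallel to it.
    rw [hc, MultilinearMap.map_update_smul, ← hfij, ← hx, ← map_smul] at h1
    have h3 := hinj h1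
    rw [← MultilinearMap.map_update_smul] at h3
    obtain ⟨d, hd⟩ := exists_smul_of_tprod_eq h3.symm (tprod_ne_zero ha) l'
    rw [update_of_ne hij, update_self] at hd
    exact hi d hd

/-- The same operator fixes that product vector if it maps its translate in slot `i` along `e i`
to a multiple of itself too. -/
theorem map_tprod_eq_self {R : (⨂[K] i, E i) →ₗ[K] (⨂[K] i, E i)}
    {a e : (i : ι) → E i} (ha : ∀ i, a i ≠ 0) {i : ι} (hi : ∀ c : K, a i ≠ c • e i)
    (he : e i ≠ 0)
    (hfi : R (pureTensor K (update a i (e i))) = pureTensor K (update a i (e i)))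
    {c d : K} (h1 : R (pureTensor K a) = c • pureTensor K a)
    (h2 : R (pureTensor K (update a i (a i + e i))) = d • pureTensor K (update a i (a i + e i))) :
    R (pureTensor K a) = pureTensor K a := by
  rw [MultilinearMap.map_update_add, map_add, update_eq_self, hfi, h1, smul_add] at h2
  -- Slot `i` separates the two product vectors, so both coefficients must vanish, whence c = d = 1.
  have h3 : (c - d) • pureTensor K a = (d - 1) • pureTensor K (update a i (e i)) := by
    rw [sub_smul, sub_smul, one_smul]
    rw [sub_eq_sub_iff_add_eq_add, h2, add_comm]
  by_cases hcd : c - d = 0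
  · rw [hcd, zero_smul, eq_comm, smul_eq_zero, or_iff_left
      (tprod_ne_zero (update_ne_zero ha he))] at h3
    rw [h1, show c = 1 by linear_combination hcd + h3, one_smul]
  · exfalso
    have h4 : pureTensor K (update a i (((c - d)⁻¹ * (d - 1)) • e i)) = pureTensor K a := by
      rw [MultilinearMap.map_update_smul, mul_smul, ← h3, smul_smul, inv_mul_cancel₀ hcd,
        one_smul]
    obtain ⟨r, hr⟩ := exists_smul_of_tprod_eq h4 (tprod_ne_zero ha) i
    rw [update_self, smul_smul] at hr
    exact hi _ hr

/-- An injective operator that maps product vectors to product vectors and fixes those differing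
from `e` in at most one slot fixes all product vectors. -/
theorem map_tprod_eq_self_of_fix {R : (⨂[K] i, E i) →ₗ[K] (⨂[K] i, E i)}
    (hinj : Function.Injective R) (hR : ∀ a, ∃ b, R (pureTensor K a) = pureTensor K b)
    {e : (i : ι) → E i} (he : ∀ i, e i ≠ 0)
    (hfix : ∀ i x, R (pureTensor K (update e i x)) = pureTensor K (update e i x)) [Nonempty ι]
    (a : (i : ι) → E i) : R (pureTensor K a) = pureTensor K a := by
  -- Induction on the number of slots in which `a` may differ from `e`.
  suffices H : ∀ (m : ℕ) (s : Finset ι), s.card = m → ∀ a : (i : ι) → E i,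
      (∀ i ∉ s, a i = e i) → R (pureTensor K a) = pureTensor K a from
    H _ Finset.univ rfl a (by simp)
  intro m
  induction m using Nat.strong_induction_on with
  | _ m ih =>
    intro s hs a hsa
    by_cases ha : ∃ i, a i = 0
    · obtain ⟨i, hi⟩ := ha
      rw [(pureTensor K).map_coord_zero i hi, map_zero]
    push Not at ha
    have reset : ∀ i ∈ s, ∀ b : (k : ι) → E k, (∀ k, k ∉ s → b k = e k) →
        R (pureTensor K (update b i (e i))) = pureTensor K (update b i (e i)) := by
      intro i his b hb
      refine ih _ ?_ (s.erase i) rfl _ fun k hk => ?_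
      · rw [← hs]
        exact Finset.card_erase_lt_of_mem his
      · obtain rfl | hki := eq_or_ne k i
        · simp
        · rw [update_of_ne hki]
          exact hb k fun h => hk (Finset.mem_erase.mpr ⟨hki, h⟩)
    have par : ∀ i ∈ s, (∃ c : K, a i = c • e i) → R (pureTensor K a) = pureTensor K a := by
      rintro i his ⟨c, hc⟩
      have : pureTensor K a = c • pureTensor K (update a i (e i)) := by
        rw [← MultilinearMap.map_update_smul, ← hc, update_eq_self]
      rw [this, map_smul, reset i his a hsa]
    by_cases h2 : 1 < s.card
    · obtain ⟨i, his, j, hjs, hij⟩ := Finset.one_lt_card.mp h2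
      by_cases hi : ∃ c : K, a i = c • e i
      · exact par i his hi
      by_cases hj : ∃ c : K, a j = c • e j
      · exact par j hjs hj
      push Not at hi hj
      have mult : ∀ b : (k : ι) → E k, (∀ k, b k ≠ 0) → (∀ k, k ∉ s → b k = e k) →
          (∀ c : K, b i ≠ c • e i) → (∀ c : K, b j ≠ c • e j) →
          ∃ c : K, R (pureTensor K b) = c • pureTensor K b := by
        intro b hb hbs hbi hbj
        refine exists_map_tprod_eq_smul hinj hR hb he hij hbi hbj (reset i his b hbs)
          (reset j hjs b hbs) (reset j hjs _ fun k hk => ?_)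
        rw [update_of_ne (by rintro rfl; exact hk his), hbs k hk]
      obtain ⟨c, hc⟩ := mult a ha hsa hi hj
      have hi' : ∀ c : K, a i + e i ≠ c • e i := fun c h =>
        hi (c - 1) (by rw [sub_smul, one_smul, ← h, add_sub_cancel_right])
      obtain ⟨d, hd⟩ := mult (update a i (a i + e i))
        (update_ne_zero ha fun h => hi' 0 (by rw [h, zero_smul]))
        (fun k hk => by rw [update_of_ne (by rintro rfl; exact hk his), hsa k hk])
        (by simpa using hi') (by simpa [hij.symm] using hj)
      exact map_tprod_eq_self ha hi (he i) (reset i his a hsa) hc hd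
    · obtain ⟨i, hi⟩ : ∃ i, s ⊆ {i} := Finset.card_le_one_iff_subset_singleton.mp (not_lt.mp h2)
      have : a = update e i (a i) := by
        funext k
        obtain rfl | hk := eq_or_ne k i
        · simp
        · rw [update_of_ne hk]
          exact hsa k fun h => hk (by simpa using hi h)
      rw [this]
      exact hfix i _

theorem toLinearMap_tprod_injective {b : (i : ι) → E i} (hb : ∀ i, b i ≠ 0) (j : ι) :
    Function.Injective ((pureTensor K).toLinearMap b j) := by
  rw [injective_iff_map_eq_zero]
  intro z hz
  by_contra h
  exact tprod_ne_zero (update_ne_zero hb h) hz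

/-! ### The map on slots induced by an operator -/

/-- An injective operator that maps product vectors to product vectors maps the product vectors
differing from `e` in the slot `i` to product vectors differing from the image of `e` in one and
the same slot. -/
theorem exists_slot [Nonempty ι] {T : (⨂[K] i, E i) →ₗ[K] (⨂[K] i, E i)}
    (hinj : Function.Injective T)
    (hT : ∀ a, ∃ b, T (pureTensor K a) = pureTensor K b)
    {e b : (i : ι) → E i} (he : ∀ i, e i ≠ 0) (hb : ∀ i, b i ≠ 0)
    (heb : T (pureTensor K e) = pureTensor K b) (i : ι) :
    ∃ j, (∀ y, ∃ z, T (pureTensor K (update e i y)) =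
        pureTensor K (update b j z)) ∧
      ((∀ y, ∃ c : K, y = c • e i) → j = i) := by
  have scalar : ∀ j (c : K), T (pureTensor K (update e i (c • e i))) =
      pureTensor K (update b j (c • b j)) := by
    intro j c
    rw [MultilinearMap.map_update_smul, MultilinearMap.map_update_smul, update_eq_self,
      update_eq_self, map_smul, heb]
  -- When slot `i` is a line, every target slot works; choosing `i` itself is what later makes the
  -- slot map injective.
  by_cases hpar : ∀ y, ∃ c : K, y = c • e i
  · refine ⟨i, fun y => ?_, fun _ => rfl⟩
    obtain ⟨c, rfl⟩ := hpar y
    exact ⟨_, scalar i c⟩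
  have line : ∀ y, ∃ j z, T (pureTensor K (update e i y)) =
      pureTensor K (update b j z) := by
    intro y
    obtain ⟨x, hx⟩ := hT (update e i y)
    obtain ⟨x', hx'⟩ := hT (update e i (e i + y))
    rw [MultilinearMap.map_update_add, map_add, update_eq_self, heb, hx] at hx'
    rw [hx]
    exact eq_tprod_update_of_add hx' hb
  have npar : ∀ y j z, (∀ c : K, y ≠ c • e i) → T (pureTensor K (update e i y)) =
      pureTensor K (update b j z) → ∀ c : K, z ≠ c • b j := by
    rintro y j _ hy h c rfl
    rw [← scalar j c] at h
    exact hy c (toLinearMap_tprod_injective he i (hinj h))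
  push Not at hpar
  obtain ⟨y₁, hy₁⟩ := hpar
  obtain ⟨j, z₁, hz₁⟩ := line y₁
  refine ⟨j, fun y => ?_, fun h => ?_⟩
  · by_cases hy : ∃ c : K, y = c • e i
    · obtain ⟨c, rfl⟩ := hy
      exact ⟨_, scalar j c⟩
    push Not at hy
    obtain ⟨j', z, hz⟩ := line y
    obtain rfl | hjj := eq_or_ne j' j
    · exact ⟨z, hz⟩
    exfalso
    -- If two directions went to different slots, the image of their sum would be a sum of product
    -- vectors not parallel in two slots.
    obtain ⟨x, hx⟩ := hT (update e i (y₁ + y))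
    rw [MultilinearMap.map_update_add, map_add, hz₁, hz] at hx
    have h1 := npar _ _ _ hy₁ hz₁
    have h2 := npar _ _ _ hy hz
    have hz₁0 : z₁ ≠ 0 := fun h => h1 0 (by simpa)
    have hz0 : z ≠ 0 := fun h => h2 0 (by simpa)
    obtain ⟨r, hr⟩ := parallel_of_tprod_add hx (update_ne_zero hb hz₁0) (update_ne_zero hb hz0)
      hjj (by simpa [hjj] using h2)
    rw [update_self, update_of_ne hjj.symm] at hr
    have hr0 : r ≠ 0 := by
      rintro rfl
      exact hb j (by simpa using hr)
    exact h1 r⁻¹ (by rw [hr, smul_smul, inv_mul_cancel₀ hr0, one_smul])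
  · obtain ⟨c, hc⟩ := h y₁
    exact absurd hc (hy₁ c)

/-- The linear map between slots induced by an operator as in `exists_slot`. -/
theorem exists_slotMap {T : (⨂[K] i, E i) →ₗ[K] (⨂[K] i, E i)} {e b : (i : ι) → E i}
    (hb : ∀ i, b i ≠ 0) {i j : ι}
    (h : ∀ y, ∃ z, T (pureTensor K (update e i y)) =
      pureTensor K (update b j z)) :
    ∃ V : E i →ₗ[K] E j, ∀ y, T (pureTensor K (update e i y)) =
      pureTensor K (update b j (V y)) := by
  have hg := toLinearMap_tprod_injective (K := K) hb j
  let g := LinearEquiv.ofInjective _ hg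
  let f := (T ∘ₗ (pureTensor K).toLinearMap e i).codRestrict
    (LinearMap.range ((pureTensor K).toLinearMap b j))
    fun y => (h y).imp fun z hz => hz.symm
  refine ⟨g.symm.toLinearMap ∘ₗ f, fun y => ?_⟩
  exact (congrArg Subtype.val (g.apply_symm_apply (f y))).symm

/-- Different slots have different images. -/
theorem slot_injective {T : (⨂[K] i, E i) ≃ₗ[K] (⨂[K] i, E i)}
    (hT : ∀ a, ∃ b, T.symm (pureTensor K a) = pureTensor K b)
    {e b : (i : ι) → E i} (he : ∀ i, e i ≠ 0) {i i' j : ι} {y : E i} {y' : E i'} {z z' : E j}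
    (h : T (pureTensor K (update e i y)) = pureTensor K (update b j z))
    (h' : T (pureTensor K (update e i' y')) = pureTensor K (update b j z'))
    (hy : ∀ c : K, y ≠ c • e i) (hy' : ∀ c : K, y' ≠ c • e i') : i = i' := by
  by_contra hne
  -- The inverse image of this vector is a sum of two product vectors that leave `e` in different
  -- slots, which cannot be a product vector.
  obtain ⟨x, hx⟩ := hT (update b j (z + z'))
  rw [MultilinearMap.map_update_add, ← h, ← h', map_add, T.symm_apply_apply,
    T.symm_apply_apply] at hx
  have hy0 : y ≠ 0 := fun h => hy 0 (by simpa)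
  have hy0' : y' ≠ 0 := fun h => hy' 0 (by simpa)
  obtain ⟨r, hr⟩ := parallel_of_tprod_add hx (update_ne_zero he hy0) (update_ne_zero he hy0')
    (Ne.symm hne) (by simpa [Ne.symm hne] using hy')
  rw [update_self, update_of_ne hne] at hr
  have hr0 : r ≠ 0 := by
    rintro rfl
    exact he i (by simpa using hr)
  exact hy r⁻¹ (by rw [hr, smul_smul, inv_mul_cancel₀ hr0, one_smul])

end Field

end ProductVector

/-! ### Separable states, local unitaries and swaps -/

namespace Multipartite

open Function

variable {p : ℕ} {n : Fin p → ℕ}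

theorem IsSeparable.ne_zero {w : Space n} (hw : IsSeparable w) : w ≠ 0 := by
  rintro rfl
  have := hw.isPureState
  simp [IsPureState, braket] at this

theorem exists_tprod_eq_smul [NeZero p] (c : ℂ) (a : (i : Fin p) → Hil (n i)) :
    ∃ b, c • PiTensorProduct.tprod ℂ a = PiTensorProduct.tprod ℂ b :=
  ⟨update a 0 (c • a 0), by rw [MultilinearMap.map_update_smul, update_eq_self]⟩

/-- Every product vector with nonzero factors is a multiple of a separable state. -/
theorem exists_smul_isSeparable {a : (i : Fin p) → Hil (n i)} (ha : ∀ i, a i ≠ 0) :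
    ∃ (c : ℂ) (w : Space n), IsSeparable w ∧ PiTensorProduct.tprod ℂ a = c • w := by
  refine ⟨∏ i, (‖a i‖ : ℂ), _, ⟨fun i => (‖a i‖ : ℂ)⁻¹ • a i, fun i => ?_, rfl⟩, ?_⟩
  · rw [norm_smul, norm_inv, Complex.norm_real, norm_norm, inv_mul_cancel₀]
    exact norm_ne_zero_iff.mpr (ha i)
  · rw [← MultilinearMap.map_smul_univ]
    congr 1
    funext i
    rw [smul_smul, mul_inv_cancel₀, one_smul]
    exact_mod_cast norm_ne_zero_iff.mpr (ha i)

/-- Homogeneity removes the normalisation; a product with a zero factor is mapped to 0, again a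
product. -/
theorem exists_map_tprod_eq_tprod [NeZero p] {T : Space n →ₗ[ℂ] Space n}
    (hT : ∀ w, IsSeparable w → IsSeparable (T w)) (a : (i : Fin p) → Hil (n i)) :
    ∃ b, T (PiTensorProduct.tprod ℂ a) = PiTensorProduct.tprod ℂ b := by
  by_cases ha : ∀ i, a i ≠ 0
  · obtain ⟨c, w, hw, h⟩ := exists_smul_isSeparable ha
    obtain ⟨b, -, hb⟩ := hT w hw
    rw [h, map_smul, hb]
    exact exists_tprod_eq_smul c b
  · push Not at ha
    obtain ⟨i, hi⟩ := ha
    exact ⟨a, by rw [(PiTensorProduct.tprod ℂ).map_coord_zero i hi, map_zero]⟩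

theorem isPureState_tprod_update {b : (i : Fin p) → Hil (n i)} (hb : ∀ i, ‖b i‖ = 1) {j : Fin p}
    {z : Hil (n j)} (h : IsPureState (PiTensorProduct.tprod ℂ (update b j z) : Space n)) :
    ‖z‖ = 1 := by
  rw [IsPureState, braket_tprod, Fintype.prod_eq_single j] at h
  · rw [update_self, inner_self_eq_norm_sq_to_K] at h
    have h2 : ‖z‖ ^ 2 = 1 := Complex.ofReal_injective (by simpa using h)
    nlinarith [norm_nonneg z]
  · intro k hk
    simp [hk, inner_self_eq_norm_sq_to_K, hb]

/-- A local unitary operation followed by a swap. -/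
def swapLocal (V : (i : Fin p) → (Hil (n i) ≃ₗᵢ[ℂ] Hil (n i))) (σ : Equiv.Perm (Fin p))
    (h : ∀ i, n (σ i) = n i) : Space n →ₗ[ℂ] Space n :=
  swapOp σ h ∘ₗ PiTensorProduct.map (fun i => (V i).toLinearEquiv.toLinearMap)

section SwapLocal

variable (V : (i : Fin p) → (Hil (n i) ≃ₗᵢ[ℂ] Hil (n i))) (σ : Equiv.Perm (Fin p))
  (h : ∀ i, n (σ i) = n i)

theorem swapLocal_tprod (a : (i : Fin p) → Hil (n i)) :
    swapLocal V σ h (PiTensorProduct.tprod ℂ a) =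
      PiTensorProduct.tprod ℂ fun i => hilCongr (h i) (V (σ i) (a (σ i))) := by
  rw [swapLocal, LinearMap.comp_apply, PiTensorProduct.map_tprod, swapOp_tprod]
  rfl

/-- Sesquilinearity reduces this to product vectors, where the swap only permutes the factors of the
product of inner products. -/
theorem braket_swapLocal (x y : Space n) :
    braket (swapLocal V σ h x) (swapLocal V σ h y) = braket x y := by
  induction x using PiTensorProduct.induction_on with
  | smul_tprod r a =>
    induction y using PiTensorProduct.induction_on with
    | smul_tprod s c =>
      have key : braket (swapLocal V σ h (PiTensorProduct.tprod ℂ a))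
          (swapLocal V σ h (PiTensorProduct.tprod ℂ c)) =
          braket (PiTensorProduct.tprod ℂ a) (PiTensorProduct.tprod ℂ c) := by
        rw [swapLocal_tprod, swapLocal_tprod, braket_tprod, braket_tprod]
        simp only [LinearIsometryEquiv.inner_map_map]
        exact Equiv.prod_comp σ fun i => ⟪a i, c i⟫_ℂ
      simp only [braket, map_smul, inner_smul_left, inner_smul_right] at key ⊢
      rw [key]
    | add y z hy hz =>
      simp only [braket, map_add, inner_add_right] at hy hz ⊢
      rw [hy, hz]
  | add x z hx hz =>
    simp only [braket, map_add, inner_add_left] at hx hz ⊢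
    rw [hx, hz]

theorem swapLocal_injective : Function.Injective (swapLocal V σ h) := by
  rw [injective_iff_map_eq_zero]
  intro x hx
  have := braket_swapLocal V σ h x x
  rw [hx] at this
  simpa [braket] using this.symm

theorem isSeparable_swapLocal {w : Space n} (hw : IsSeparable w) :
    IsSeparable (swapLocal V σ h w) := by
  obtain ⟨a, ha, rfl⟩ := hw
  exact ⟨_, fun i => by simp [ha], swapLocal_tprod V σ h a⟩

theorem hilCongr_hilCongr {d e : ℕ} (h : d = e) (h' : e = d) (v : Hil d) :
    hilCongr h' (hilCongr h v) = v := by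
  ext k
  simp [hilCongr_apply]

theorem hilCongr_congr (x : (i : Fin p) → Hil (n i)) {i j : Fin p} (hij : i = j) {d : ℕ}
    (hi : n i = d) (hj : n j = d) : hilCongr hi (x i) = hilCongr hj (x j) := by
  subst hij
  rfl

theorem exists_swapLocal_eq {w : Space n} (hw : IsSeparable w) :
    ∃ w', IsSeparable w' ∧ swapLocal V σ h w' = w := by
  obtain ⟨a, ha, rfl⟩ := hw
  have h' : ∀ i, n (σ.symm i) = n i := fun i => by rw [← h, σ.apply_symm_apply]
  refine ⟨_, ⟨fun i => (V i).symm (hilCongr (h' i) (a (σ.symm i))), fun i => by simp [ha], rfl⟩, ?_⟩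
  rw [swapLocal_tprod]
  congr 1
  funext i
  rw [LinearIsometryEquiv.apply_symm_apply,
    hilCongr_congr a (σ.symm_apply_apply i) _ (h i).symm, hilCongr_hilCongr]

end SwapLocal

/-! ### Automorphisms preserving separable states -/

/-- A linear automorphism which maps separable states to separable states in both directions is
a local unitary operation followed by a swap. -/
theorem exists_eq_swapLocal (hp : 1 ≤ p) (hn : ∀ i, 0 < n i) (T : Space n ≃ₗ[ℂ] Space n)
    (hT : ∀ w, IsSeparable w → IsSeparable (T w))
    (hT' : ∀ w, IsSeparable w → IsSeparable (T.symm w)) :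
    ∃ (V : (i : Fin p) → (Hil (n i) ≃ₗᵢ[ℂ] Hil (n i))) (σ : Equiv.Perm (Fin p))
      (h : ∀ i, n (σ i) = n i), T.toLinearMap = swapLocal V σ h := by
  have : NeZero p := ⟨by omega⟩
  let e : (i : Fin p) → Hil (n i) := fun i => EuclideanSpace.single ⟨0, hn i⟩ 1
  have he1 : ∀ i, ‖e i‖ = 1 := fun i => by simp [e]
  have he : ∀ i, e i ≠ 0 := fun i => norm_ne_zero_iff.mp (by simp [he1])
  obtain ⟨b, hb1, heb⟩ := hT _ ⟨e, he1, rfl⟩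
  have hb : ∀ i, b i ≠ 0 := fun i => norm_ne_zero_iff.mp (by simp [hb1])
  have hTp := exists_map_tprod_eq_tprod (T := T.toLinearMap) hT
  have hTp' := exists_map_tprod_eq_tprod (T := T.symm.toLinearMap) hT'
  choose σ hσ hσ1 using ProductVector.exists_slot (T := T.toLinearMap) T.injective hTp he hb heb
  choose V hV using fun i => ProductVector.exists_slotMap hb (hσ i)
  simp only [LinearEquiv.coe_coe] at hV
  have hVe : ∀ i, V i (e i) = b (σ i) := by
    intro i
    refine ProductVector.toLinearMap_tprod_injective (K := ℂ) hb (σ i) ?_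
    simp [← hV, heb]
  have hVn : ∀ i y, ‖V i y‖ = ‖y‖ := by
    intro i y
    by_cases hy : y = 0
    · simp [hy]
    have hy' : ‖y‖ ≠ 0 := norm_ne_zero_iff.mpr hy
    have h1 : ‖V i ((‖y‖ : ℂ)⁻¹ • y)‖ = 1 := by
      refine isPureState_tprod_update hb1 ?_
      rw [← hV]
      refine (hT _ ⟨_, fun k => ?_, rfl⟩).isPureState
      obtain rfl | hk := eq_or_ne k i
      · rw [update_self, norm_smul, norm_inv, Complex.norm_real, norm_norm, inv_mul_cancel₀ hy']
      · rw [update_of_ne hk, he1]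
    rwa [map_smul, norm_smul, norm_inv, Complex.norm_real, norm_norm, inv_mul_eq_one₀ hy',
      eq_comm] at h1
  let W : (i : Fin p) → Hil (n i) →ₗᵢ[ℂ] Hil (n (σ i)) := fun i => ⟨V i, hVn i⟩
  have hle : ∀ i, n i ≤ n (σ i) := by
    intro i
    simpa using LinearMap.finrank_le_finrank_of_injective (f := V i) (W i).injective
  have hdim : ∀ i, (∀ y, ∃ c : ℂ, y = c • e i) ∨ ∃ y, ∀ c : ℂ, y ≠ c • e i := by
    intro i
    by_contra! h
    obtain ⟨⟨y, hy⟩, h⟩ := h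
    obtain ⟨c, hc⟩ := h y
    exact hy c hc
  have hone : ∀ i, (∀ y, ∃ c : ℂ, y = c • e i) ↔ n i = 1 := by
    intro i
    have h := finrank_eq_one_iff_of_nonzero' (K := ℂ) _ (he i)
    rw [finrank_euclideanSpace_fin] at h
    simp only [h, eq_comm]
  -- A one-dimensional slot is sent to itself, and no larger slot embeds in it. For two larger slots
  -- `slot_injective` applies.
  have hinj : Function.Injective σ := by
    intro i i' hii
    rcases hdim i with hi | ⟨y, hy⟩
    · have h1 := hσ1 i hi
      rcases hdim i' with hi' | ⟨y', hy'⟩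
      · rw [← h1, hii, hσ1 i' hi']
      · exfalso
        have h2 := hle i'
        rw [← hii, h1, (hone i).mp hi] at h2
        obtain ⟨c, hc⟩ := (hone i').mpr (le_antisymm h2 (hn i')) y'
        exact hy' c hc
    · rcases hdim i' with hi' | ⟨y', hy'⟩
      · exfalso
        have h1 := hσ1 i' hi'
        have h2 := hle i
        rw [hii, h1, (hone i').mp hi'] at h2
        obtain ⟨c, hc⟩ := (hone i).mpr (le_antisymm h2 (hn i)) y
        exact hy c hc
      · have h1 := hV i y
        have h2 := hV i' y'
        generalize V i y = z at h1
        generalize V i' y' = z' at h2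
        generalize σ i = j at *
        subst hii
        exact ProductVector.slot_injective hTp' he h1 h2 hy hy'
  let τ : Equiv.Perm (Fin p) := Equiv.ofBijective σ (Finite.injective_iff_bijective.mp hinj)
  have hτ : ∀ i, τ i = σ i := fun i => rfl
  -- Termwise `n i ≤ n (σ i)`, while the sums agree because `σ` is a permutation.
  have hdimσ : ∀ i, n i = n (σ i) := by
    have h := (Finset.sum_eq_sum_iff_of_le (s := Finset.univ) fun i _ => hle i).mp
      (Equiv.sum_comp τ n).symm
    exact fun i => h i (Finset.mem_univ i)
  have hdimτ : ∀ i, n (τ.symm i) = n i := fun i => by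
    rw [hdimσ, ← hτ, τ.apply_symm_apply]
  let V' : (i : Fin p) → (Hil (n i) ≃ₗᵢ[ℂ] Hil (n i)) := fun i =>
    ((hilCongr (hdimσ i).symm).toLinearIsometry.comp (W i)).toLinearIsometryEquiv rfl
  have hV' : ∀ i y, hilCongr (hdimσ i) (V' i y) = V i y := fun i y => hilCongr_hilCongr _ _ _
  -- The inverse appears because `V i` moves slot `i` to slot `σ i`, whereas `swapOp` reads the
  -- content of its slot `i` from the permuted index.
  refine ⟨V', τ.symm, hdimτ, ?_⟩
  have hline : ∀ i y, swapLocal V' τ.symm hdimτ (PiTensorProduct.tprod ℂ (update e i y)) =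
      T (PiTensorProduct.tprod ℂ (update e i y)) := by
    intro i y
    rw [hV, swapLocal_tprod]
    congr 1
    funext k
    obtain ⟨l, rfl⟩ := τ.surjective k
    refine (hilCongr_congr (fun m => V' m (update e i y m)) (τ.symm_apply_apply l) _
      (hdimσ l)).trans ?_
    rw [hV']
    change _ = update b (σ i) (V i y) (σ l)
    obtain rfl | hl := eq_or_ne l i
    · simp
    · rw [update_of_ne hl, update_of_ne (hinj.ne hl), hVe]
  have hfix := ProductVector.map_tprod_eq_self_of_fix
    (R := T.symm.toLinearMap ∘ₗ swapLocal V' τ.symm hdimτ)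
    (T.symm.injective.comp (swapLocal_injective _ _ _))
    (fun a => by
      rw [LinearMap.comp_apply, swapLocal_tprod]
      exact hTp' _) he
    (fun i x => by
      rw [LinearMap.comp_apply, hline]
      exact T.symm_apply_apply _)
  refine PiTensorProduct.ext (MultilinearMap.ext fun a => ?_)
  have h := congrArg T (hfix a)
  rw [LinearMap.comp_apply, LinearEquiv.coe_coe, T.apply_symm_apply] at h
  exact h.symm

/-! ### Adjoints and the largest overlap -/

theorem braket_self (x : Space n) : braket x x = ((‖coords n x‖ ^ 2 : ℝ) : ℂ) := by
  rw [braket, inner_self_eq_norm_sq_to_K]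
  simp

theorem isPureState_iff {x : Space n} : IsPureState x ↔ ‖coords n x‖ = 1 := by
  rw [IsPureState, braket_self, Complex.ofReal_eq_one,
    pow_eq_one_iff_of_nonneg (norm_nonneg _) two_ne_zero]

theorem eq_of_braket_eq {x y : Space n} (h : ∀ z, braket z x = braket z y) : x = y := by
  refine (coords n).injective (ext_inner_left ℂ fun z => ?_)
  simpa [braket] using h ((coords n).symm z)

/-- The adjoint of an operator with respect to `braket`. -/
def dagger (U : Space n →ₗ[ℂ] Space n) : Space n →ₗ[ℂ] Space n :=
  (coords n).symm.toLinearMap ∘ₗ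
    LinearMap.adjoint ((coords n).toLinearMap ∘ₗ U ∘ₗ (coords n).symm.toLinearMap) ∘ₗ
      (coords n).toLinearMap

theorem braket_dagger (U : Space n →ₗ[ℂ] Space n) (x y : Space n) :
    braket (dagger U x) y = braket x (U y) := by
  simp [braket, dagger, LinearMap.adjoint_inner_left]

theorem braket_conj (x y : Space n) : star (braket x y) = braket y x :=
  inner_conj_symm (coords n y) (coords n x)

theorem braket_dagger_right (U : Space n →ₗ[ℂ] Space n) (x y : Space n) :
    braket x (dagger U y) = braket (U x) y := by
  rw [← braket_conj, braket_dagger, braket_conj]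

theorem dagger_dagger_apply {U W : Space n →ₗ[ℂ] Space n} (h : ∀ x, U (W x) = x)
    (x : Space n) : dagger W (dagger U x) = x :=
  eq_of_braket_eq fun z => by rw [braket_dagger_right, braket_dagger_right, h]

theorem norm_braket_le {w : Space n} (hw : IsSeparable w) (v : Space n) :
    ‖braket w v‖ ≤ ‖coords n v‖ := by
  have h := norm_inner_le_norm (𝕜 := ℂ) (coords n w) (coords n v)
  rwa [isPureState_iff.mp hw.isPureState, one_mul] at h

theorem norm_braket_sq_le_sSup {w : Space n} (hw : IsSeparable w) (v : Space n) :
    ‖braket w v‖ ^ 2 ≤ sSup (overlaps v) :=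
  le_csSup (overlaps_bddAbove v) ⟨w, hw, rfl⟩

theorem sSup_overlaps_le (hn : ∀ i, 0 < n i) (v : Space n) :
    sSup (overlaps v) ≤ ‖coords n v‖ ^ 2 := by
  refine csSup_le (overlaps_nonempty hn v) ?_
  rintro r ⟨w, hw, rfl⟩
  exact pow_le_pow_left₀ (norm_nonneg _) (norm_braket_le hw v) 2

/-- The overlaps are a continuous image of a product of unit spheres, compact in finite dimension.
-/
theorem isCompact_overlaps (v : Space n) : IsCompact (overlaps v) := by
  have h : overlaps v =
      (fun a : (i : Fin p) → Hil (n i) => ‖braket (PiTensorProduct.tprod ℂ a) v‖ ^ 2) ''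
        Set.univ.pi fun i => Metric.sphere (0 : Hil (n i)) 1 := by
    ext r
    constructor
    · rintro ⟨w, ⟨a, ha, rfl⟩, rfl⟩
      exact ⟨a, by simpa using ha, rfl⟩
    · rintro ⟨a, ha, rfl⟩
      exact ⟨_, ⟨a, by simpa using ha, rfl⟩, rfl⟩
  rw [h]
  refine (isCompact_univ_pi fun i => isCompact_sphere _ _).image ?_
  simp only [braket, PiLp.inner_apply, coords_tprod]
  fun_prop

/-- The supremum in the geometric measure of entanglement is attained. -/
theorem exists_norm_braket_sq_eq (hn : ∀ i, 0 < n i) (v : Space n) :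
    ∃ w, IsSeparable w ∧ sSup (overlaps v) = ‖braket w v‖ ^ 2 :=
  (isCompact_overlaps v).sSup_mem (overlaps_nonempty hn v)

theorem sSup_overlaps_of_isSeparable (hn : ∀ i, 0 < n i) {w : Space n} (hw : IsSeparable w) :
    sSup (overlaps w) = 1 := by
  refine le_antisymm ?_ ?_
  · simpa [isPureState_iff.mp hw.isPureState] using sSup_overlaps_le hn w
  · have h : braket w w = 1 := hw.isPureState
    simpa [h] using norm_braket_sq_le_sSup hw w

open scoped Pointwise in
theorem sSup_overlaps_smul (c : ℂ) (v : Space n) :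
    sSup (overlaps (c • v)) = ‖c‖ ^ 2 * sSup (overlaps v) := by
  have h : overlaps (c • v) = (‖c‖ ^ 2) • overlaps v := by
    ext r
    simp only [overlaps, Set.mem_smul_set, Set.mem_ofPred_eq]
    constructor
    · rintro ⟨w, hw, rfl⟩
      exact ⟨_, ⟨w, hw, rfl⟩, by simp [braket, mul_pow]⟩
    · rintro ⟨_, ⟨w, hw, rfl⟩, rfl⟩
      exact ⟨w, hw, by simp [braket, mul_pow]⟩
  rw [h, Real.sSup_smul_of_nonneg (sq_nonneg _), smul_eq_mul]

/-- Quadratic homogeneity frees the hypothesis from normalisation, so that it applies to vectors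
such as `dagger U z`, whose norm is not yet known. -/
theorem sSup_overlaps_map {U : Space n →ₗ[ℂ] Space n}
    (hU : ∀ v, IsPureState v → geomEnt (U v) = geomEnt v) (v : Space n) :
    sSup (overlaps (U v)) = sSup (overlaps v) := by
  by_cases hv : v = 0
  · simp [hv]
  have hc : ‖coords n v‖ ≠ 0 := by simpa using hv
  have h1 := hU ((‖coords n v‖ : ℂ)⁻¹ • v)
    (isPureState_iff.mpr (by simp [norm_smul, inv_mul_cancel₀ hc]))
  rw [geomEnt, geomEnt, map_smul, sSup_overlaps_smul, sSup_overlaps_smul, sub_right_inj] at h1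
  exact mul_left_cancel₀ (by simpa using hv) h1

/-- The coordinates of `v` are its overlaps with the product basis states, which are separable. -/
theorem eq_zero_of_sSup_overlaps {v : Space n} (h : sSup (overlaps v) = 0) : v = 0 := by
  refine (coords n).injective (PiLp.ext fun f => ?_)
  have hs : IsSeparable (PiTensorProduct.tprod ℂ fun i =>
      (EuclideanSpace.single (f i) 1 : Hil (n i)) : Space n) := ⟨_, by simp, rfl⟩
  have h1 := norm_braket_sq_le_sSup hs v
  have h2 : coords n (PiTensorProduct.tprod ℂ fun i =>
      (EuclideanSpace.single (f i) 1 : Hil (n i))) = EuclideanSpace.single f 1 := by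
    ext g
    rw [coords_tprod]
    by_cases hg : g = f
    · subst hg
      simp
    · obtain ⟨i, hi⟩ := Function.ne_iff.mp hg
      rw [Finset.prod_eq_zero (Finset.mem_univ i) (by simp [hi])]
      simp [hg]
  rw [h, braket, h2, EuclideanSpace.inner_single_left] at h1
  simpa using le_antisymm h1 (sq_nonneg _)

theorem IsSeparable.smul (hp : 1 ≤ p) {w : Space n} (hw : IsSeparable w) {c : ℂ}
    (hc : ‖c‖ = 1) : IsSeparable (c • w) := by
  obtain ⟨a, ha, rfl⟩ := hw
  refine ⟨Function.update a ⟨0, hp⟩ (c • a ⟨0, hp⟩), fun i => ?_, ?_⟩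
  · obtain rfl | hi := eq_or_ne i ⟨0, hp⟩
    · simp [norm_smul, hc, ha]
    · simp [hi, ha]
  · rw [MultilinearMap.map_update_smul, Function.update_eq_self]

/-- Test `U (dagger U z)` against `z`: the fourth power of the norm of `dagger U z` is at most its
square. -/
theorem norm_dagger_le {U : Space n →ₗ[ℂ] Space n}
    (hU : ∀ v, sSup (overlaps (U v)) = sSup (overlaps v)) (hn : ∀ i, 0 < n i)
    {z : Space n} (hz : IsSeparable z) :
    ‖coords n (dagger U z)‖ ≤ 1 := by
  have h1 := norm_braket_sq_le_sSup hz (U (dagger U z))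
  rw [hU, ← braket_dagger, braket_self, Complex.norm_real, norm_pow, norm_norm] at h1
  have h2 := h1.trans (sSup_overlaps_le hn _)
  by_contra! h
  nlinarith [mul_pos (sub_pos.mpr h) (sub_pos.mpr h)]

/-- Every separable state is the image of a separable state under the adjoint of an operator
that preserves the largest overlap with separable states. -/
theorem exists_dagger_eq {U : Space n →ₗ[ℂ] Space n}
    (hU : ∀ v, sSup (overlaps (U v)) = sSup (overlaps v)) (hp : 1 ≤ p)
    (hn : ∀ i, 0 < n i) {w : Space n} (hw : IsSeparable w) :
    ∃ z, IsSeparable z ∧ dagger U z = w := by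
  obtain ⟨z, hz, h⟩ := exists_norm_braket_sq_eq hn (U w)
  rw [hU, sSup_overlaps_of_isSeparable hn hw, ← braket_dagger] at h
  have hw1 := isPureState_iff.mp hw.isPureState
  have h1 : ‖braket (dagger U z) w‖ = 1 := by
    nlinarith [norm_nonneg (braket (dagger U z) w)]
  have hle := norm_dagger_le hU hn hz
  have h2 := norm_inner_le_norm (𝕜 := ℂ) (coords n (dagger U z)) (coords n w)
  have h3 : ‖coords n (dagger U z)‖ = 1 := by
    change ‖braket (dagger U z) w‖ ≤ _ at h2
    rw [h1, hw1, mul_one] at h2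
    exact le_antisymm hle h2
  have h4 : ‖⟪coords n (dagger U z), coords n w⟫_ℂ‖ =
      ‖coords n (dagger U z)‖ * ‖coords n w‖ := by
    rw [h3, hw1, mul_one]
    exact h1
  -- Equality in Cauchy–Schwarz; the resulting scalar is a phase, which `z` can absorb.
  obtain ⟨c, -, hc⟩ := (norm_inner_eq_norm_iff (norm_ne_zero_iff.mp (by simp [h3]))
    (norm_ne_zero_iff.mp (by simp [hw1]))).mp h4
  have hc1 : ‖c‖ = 1 := by
    have := congrArg norm hc
    rwa [norm_smul, h3, hw1, mul_one, eq_comm] at this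
  refine ⟨c • z, hz.smul hp hc1, (coords n).injective ?_⟩
  rw [map_smul, map_smul, hc]

/-- The operator maps the separable states onto themselves and preserves `braket`. -/
theorem overlaps_swapLocal (V : (i : Fin p) → (Hil (n i) ≃ₗᵢ[ℂ] Hil (n i)))
    (σ : Equiv.Perm (Fin p)) (h : ∀ i, n (σ i) = n i) (v : Space n) :
    overlaps (swapLocal V σ h v) = overlaps v := by
  ext r
  constructor
  · rintro ⟨w, hw, rfl⟩
    obtain ⟨w', hw', rfl⟩ := exists_swapLocal_eq V σ h hw
    exact ⟨w', hw', by rw [braket_swapLocal]⟩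
  · rintro ⟨w, hw, rfl⟩
    exact ⟨_, isSeparable_swapLocal V σ h hw, by rw [braket_swapLocal]⟩

theorem exists_eq_swapLocal_of_geomEnt (hp : 1 ≤ p) (hn : ∀ i, 0 < n i)
    {U : Space n →ₗ[ℂ] Space n} (hU : ∀ v, IsPureState v → geomEnt (U v) = geomEnt v) :
    ∃ (V : (i : Fin p) → (Hil (n i) ≃ₗᵢ[ℂ] Hil (n i))) (σ : Equiv.Perm (Fin p))
      (h : ∀ i, n (σ i) = n i), U = swapLocal V σ h := by
  have hq := sSup_overlaps_map hU
  have hinj : Function.Injective U := by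
    rw [injective_iff_map_eq_zero]
    intro v hv
    refine eq_zero_of_sSup_overlaps ?_
    rw [← hq, hv, ← zero_smul ℂ (0 : Space n), sSup_overlaps_smul]
    simp
  have : FiniteDimensional ℂ (Space n) := .of_injective (coords n).toLinearMap (coords n).injective
  let W := LinearEquiv.ofInjectiveEndo U hinj
  have hWU : ∀ x, W.symm (U x) = x := W.symm_apply_apply
  have hUW : ∀ x, U (W.symm x) = x := W.apply_symm_apply
  have hq' : ∀ v, sSup (overlaps (W.symm.toLinearMap v)) = sSup (overlaps v) := fun v => by
    rw [← hq, LinearEquiv.coe_coe, hUW]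
  have hd := dagger_dagger_apply (U := W.symm.toLinearMap) (W := U) hWU
  have hd' := dagger_dagger_apply (U := U) (W := W.symm.toLinearMap) hUW
  -- T is the adjoint of U⁻¹, with inverse U†. Writing a separable state as the image of a separable
  -- `z` under one of the two shows that the other returns it to `z`.
  let T : Space n ≃ₗ[ℂ] Space n := LinearEquiv.ofLinearMap (dagger W.symm.toLinearMap) (dagger U)
    (LinearMap.ext hd') (LinearMap.ext hd)
  obtain ⟨V, σ, h, hT⟩ := exists_eq_swapLocal hp hn T
    (fun w hw => by
      obtain ⟨z, hz, rfl⟩ := exists_dagger_eq hq hp hn hw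
      change IsSeparable (dagger W.symm.toLinearMap (dagger U z))
      rwa [hd'])
    (fun w hw => by
      obtain ⟨z, hz, rfl⟩ := exists_dagger_eq hq' hp hn hw
      change IsSeparable (dagger U (dagger W.symm.toLinearMap z))
      rwa [hd])
  refine ⟨V, σ, h, LinearMap.ext fun y => eq_of_braket_eq fun x => ?_⟩
  -- With S the swap of local unitaries equal to T, ⟨x|Uy⟩ = ⟨U†x|y⟩ = ⟨S U†x|S y⟩ = ⟨x|S y⟩,
  -- because T inverts U†.
  rw [← braket_dagger, ← braket_swapLocal V σ h, ← hT]
  change braket (dagger W.symm.toLinearMap (dagger U x)) _ = _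
  rw [hd']

end Multipartite

end

theorem corollary6p5 {p : ℕ} (hp : 1 ≤ p) (n : Fin p → ℕ) (hn : ∀ i, 0 < n i)
    (U : Multipartite.Space n →ₗ[ℂ] Multipartite.Space n) :
    (∀ v : Multipartite.Space n, Multipartite.IsPureState v →
        Multipartite.geomEnt (U v) = Multipartite.geomEnt v) ↔
      ∃ (V : (i : Fin p) → (Multipartite.Hil (n i) ≃ₗᵢ[ℂ] Multipartite.Hil (n i)))
        (σ : Equiv.Perm (Fin p)) (h : ∀ i, n (σ i) = n i),
        U = Multipartite.swapOp σ h ∘ₗ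
          PiTensorProduct.map (fun i => (V i).toLinearEquiv.toLinearMap) := by
  refine ⟨Multipartite.exists_eq_swapLocal_of_geomEnt hp hn, ?_⟩
  rintro ⟨V, σ, h, rfl⟩ v -
  exact congrArg (1 - sSup ·) (Multipartite.overlaps_swapLocal V σ h v)
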